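/- For a nonempty set $S\subseteq[N]=\{1,\dots,N\}$ write $|S\rangle=\frac{1}{\sqrt{|S|}}\sum_{i\in S}|i\rangle$, let $\mathcal R_S=\mathbb 1-2|S\rangle\langle S|$ be the reflection about $|S\rangle$, and let $\mathcal O_S$ be the membership oracle, i.e. the unitary $\mathcal O_S|i\rangle|b\rangle=(1-2bx_i)|i\rangle|b\rangle$ for $i\in[N]$, $b\in\{0,1\}$, where $x_i=1$ if $i\in S$ and $x_i=0$ otherwise. Consider a quantum algorithm $Q$ that starts with $R_1$ copies of $|S\rangle$ together with a fixed finite-dimensional ancilla state independent of $S$, then applies a fixed sequence of gates, each of which is a unitary independent of $S$, an application of $\mathcal O_S$, or an application of $\mathcal R_S$, and finally measures in the computational basis and accepts if the outcome lies in a fixed set. Suppose that $Q$ applies $\mathcal O_S$ exactly $T$ times and $\mathcal R_S$ exactly $R_2$ times, and let $R=R_1+R_2$. **Theorem.** For every constant $p>\frac12$ there is a constant $c>0$, depending only on $p$, such that the following holds for all integers $w\ge 1$ and $N\ge 2w$. If $Q$ decides with success probability at least $p$ whether $|S|=w$ or $|S|=2w$, promised that one of these is the case (that is, $Q$ rejects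 with probability at least $p$ for every $S\subseteq[N]$ with $|S|=w$ and accepts with probability at least $p$ for every $S\subseteq[N]$ with $|S|=2w$), then $$T\ \ge\ c\,\sqrt{\frac Nw}\qquad\text{or}\qquad R\ \ge\ c\,\min\left\{w^{1/3},\sqrt{\frac Nw}\right\}.$$ -/

import Mathlib

open scoped Kronecker

/-- The amplitude vector of the state `|S⟩ = |S|^{-1/2} ∑_{i ∈ S} |i⟩` (for nonempty `S`). -/
noncomputable def ketS {N : ℕ} (S : Finset (Fin N)) : Fin N → ℂ :=
  fun i => if i ∈ S then ((1 / √(S.card : ℝ) : ℝ) : ℂ) else 0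

/-- The membership oracle `O_S |i⟩|b⟩ = (1 - 2 b x_i) |i⟩|b⟩`, with `x_i = 1` if `i ∈ S`
and `x_i = 0` otherwise. -/
def membershipOracle {N : ℕ} (S : Finset (Fin N)) : Matrix (Fin N × Bool) (Fin N × Bool) ℂ :=
  Matrix.diagonal fun q => 1 - 2 * (if q.2 then 1 else 0) * (if q.1 ∈ S then 1 else 0)

/-- The reflection `R_S = 1 - 2 |S⟩⟨S|` about `|S⟩`. -/
noncomputable def reflectionS {N : ℕ} (S : Finset (Fin N)) : Matrix (Fin N) (Fin N) ℂ :=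
  1 - (2 : ℂ) • Matrix.vecMulVec (ketS S) (star (ketS S))

/-- The computational basis of a machine with `r` registers holding the given copies of `|S⟩`,
an index register and a bit register (on which the oracles act), and an `m`-dimensional
workspace. -/
abbrev BasisIdx (N r m : ℕ) : Type := (Fin r → Fin N) × ((Fin N × Bool) × Fin m)

/-- The gates of a circuit: an arbitrary unitary on the whole space that does not depend on `S`,
one membership query, or one reflection about `|S⟩`. -/
inductive Gate (N r m : ℕ) : Type where
  | free (U : Matrix.unitaryGroup (BasisIdx N r m) ℂ) : Gate N r m
  | query : Gate N r m
  | reflect : Gate N r m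

/-- The operator that a gate applies when the hidden set is `S`. A query acts on the index and
bit registers, a reflection on the index register; both act as the identity elsewhere. -/
noncomputable def Gate.toMatrix {N r m : ℕ} (S : Finset (Fin N)) :
    Gate N r m → Matrix (BasisIdx N r m) (BasisIdx N r m) ℂ
  | .free U => (U : Matrix (BasisIdx N r m) (BasisIdx N r m) ℂ)
  | .query => (1 : Matrix (Fin r → Fin N) (Fin r → Fin N) ℂ) ⊗ₖ
      (membershipOracle S ⊗ₖ (1 : Matrix (Fin m) (Fin m) ℂ))
  | .reflect => (1 : Matrix (Fin r → Fin N) (Fin r → Fin N) ℂ) ⊗ₖ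
      ((reflectionS S ⊗ₖ (1 : Matrix Bool Bool ℂ)) ⊗ₖ (1 : Matrix (Fin m) (Fin m) ℂ))

/-- `1` for a membership query, `0` for any other gate. -/
def Gate.queryCost {N r m : ℕ} : Gate N r m → ℕ
  | .query => 1
  | _ => 0

/-- `1` for a reflection about `|S⟩`, `0` for any other gate. -/
def Gate.reflectCost {N r m : ℕ} : Gate N r m → ℕ
  | .reflect => 1
  | _ => 0

/-- A quantum algorithm with access to a hidden `S ⊆ [N]` through membership queries, copies of
`|S⟩` and reflections about `|S⟩`. Nothing in it depends on `S`. -/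
structure QAlgorithm (N : ℕ) where
  /-- the number of copies of `|S⟩` it receives -/
  copies : ℕ
  /-- the dimension of its workspace -/
  workDim : ℕ
  /-- the basis state in which the index, bit and workspace registers start -/
  init : (Fin N × Bool) × Fin workDim
  /-- the gates, in the order in which they are applied -/
  gates : List (Gate N copies workDim)
  /-- the outcomes of the final computational-basis measurement on which it accepts -/
  accept : Finset (BasisIdx N copies workDim)

namespace QAlgorithm

variable {N : ℕ} (Q : QAlgorithm N)

/-- The number of membership queries. -/
def queries : ℕ := (Q.gates.map Gate.queryCost).sum

/-- The number of reflections about `|S⟩`. -/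
def reflections : ℕ := (Q.gates.map Gate.reflectCost).sum

/-- The initial state `|S⟩^{⊗ copies} ⊗ |init⟩`. -/
noncomputable def initialState (S : Finset (Fin N)) : BasisIdx N Q.copies Q.workDim → ℂ :=
  fun z => (∏ k, ketS S (z.1 k)) * (if z.2 = Q.init then 1 else 0)

/-- The state after all gates have been applied in order. -/
noncomputable def finalState (S : Finset (Fin N)) : BasisIdx N Q.copies Q.workDim → ℂ :=
  Q.gates.foldl (fun ψ g => (g.toMatrix S).mulVec ψ) (Q.initialState S)

/-- The probability that the final measurement gives an accepting outcome. -/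
noncomputable def acceptProb (S : Finset (Fin N)) : ℝ :=
  ∑ z ∈ Q.accept, ‖Q.finalState S z‖ ^ 2

/-- `Q` decides with success probability at least `p` whether `|S| = w` (then it should reject)
or `|S| = 2w` (then it should accept), under the promise that one of these holds. -/
def Decides (w : ℕ) (p : ℝ) : Prop :=
  (∀ S : Finset (Fin N), S.card = w → p ≤ 1 - Q.acceptProb S) ∧
  (∀ S : Finset (Fin N), S.card = 2 * w → p ≤ Q.acceptProb S)

end QAlgorithm

/-! Averaging the acceptance probability over all `k`-element sets `S` gives `q k ∈ [0, 1]`. With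
`E` of order `R` and `D` of order `T + R`, the product `k ^ E * q k` is a polynomial in `k`
of degree at most `E + D`: amplitudes are polynomials in the membership indicators, up to a factor
`|S| ^ (-1 / 2)` for each copy of `|S⟩` and a factor `|S|⁻¹` for each reflection. Hence
`q w - q (2 * w)` can be computed by interpolation from `q (2 * w)`, `E` nodes near
`2 * E ^ 3 / i ^ 2` below `w` and `D` nodes near `N * i ^ 2 / D ^ 2` above `2 * w`. This quadratic
spacing keeps the products in the Lagrange coefficients bounded, so the `i`-th node of either kind
gets a weight of order `E ^ 3 / (w * i ^ 2)`, respectively `D ^ 2 * w / (N * i ^ 2)`. Summing over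
`i`, an algorithm that tells `w` from `2 * w` has `E ^ 3 / w` or `D ^ 2 * w / N` bounded below.
-/

section FactorialProducts

open Finset
open scoped Nat

theorem prod_erase_Icc_abs_sub {m D : ℕ} (hm : m ∈ Icc 1 D) :
    ∏ j ∈ (Icc 1 D).erase m, |(j : ℝ) - m| = (m - 1)! * (D - m)! := by
  obtain ⟨h1, hD⟩ := mem_Icc.1 hm
  have hsplit : (Icc 1 D).erase m = Ico 1 m ∪ Ioc m D := by
    ext j
    simp only [mem_erase, mem_Icc, mem_union, mem_Ico, mem_Ioc]
    omega
  have hbelow : ∏ j ∈ Ico 1 m, |(j : ℝ) - m| = (m - 1)! := by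
    rw [← prod_Ico_id_eq_factorial, Nat.cast_prod]
    refine prod_nbij' (m - ·) (m - ·) ?_ ?_ ?_ ?_ fun j hj => ?_
    any_goals intro j hj; simp only [mem_Ico] at hj ⊢; omega
    have hjm : j ≤ m := (mem_Ico.1 hj).2.le
    rw [Nat.cast_sub hjm, abs_sub_comm, abs_of_nonneg (sub_nonneg.2 (Nat.cast_le.2 hjm))]
  have habove : ∏ j ∈ Ioc m D, |(j : ℝ) - m| = (D - m)! := by
    rw [← prod_Ico_id_eq_factorial, Nat.cast_prod]
    refine prod_nbij' (· - m) (· + m) ?_ ?_ ?_ ?_ fun j hj => ?_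
    any_goals intro j hj; simp only [mem_Ico, mem_Ioc] at hj ⊢; omega
    have hmj : m ≤ j := (mem_Ioc.1 hj).1.le
    rw [Nat.cast_sub hmj, abs_of_nonneg (sub_nonneg.2 (Nat.cast_le.2 hmj))]
  rw [hsplit, prod_union (disjoint_left.2 fun j => by simp only [mem_Ico, mem_Ioc]; omega),
    hbelow, habove]

theorem factorial_mul_prod_Icc_add (m D : ℕ) :
    (m ! : ℝ) * ∏ j ∈ Icc 1 D, ((j : ℝ) + m) = (D + m)! := by
  induction D with
  | zero => simp
  | succ D ih =>
    rw [prod_Icc_succ_top (by omega), ← mul_assoc, ih, Nat.add_right_comm, Nat.factorial_succ]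
    push_cast
    ring

theorem prod_erase_Icc_sq_div_abs_sq_sub_sq {m D : ℕ} (hm : m ∈ Icc 1 D) :
    ∏ j ∈ (Icc 1 D).erase m, (j : ℝ) ^ 2 / |(j : ℝ) ^ 2 - (m : ℝ) ^ 2| =
      2 * (D ! : ℝ) ^ 2 / ((D - m)! * (D + m)!) := by
  have hm0 : (0 : ℝ) < m := Nat.cast_pos.2 (mem_Icc.1 hm).1
  have hnum : (m : ℝ) * ∏ j ∈ (Icc 1 D).erase m, (j : ℝ) = D ! := by
    rw [mul_prod_erase _ _ hm, ← Nat.cast_prod, ← Ico_add_one_right_eq_Icc,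
      prod_Ico_id_eq_factorial]
  have hadd : ((m - 1)! * m : ℝ) * (2 * m * ∏ j ∈ (Icc 1 D).erase m, ((j : ℝ) + m)) =
      (D + m)! := by
    rw [two_mul, mul_prod_erase _ (fun j : ℕ => (j : ℝ) + m) hm, ← factorial_mul_prod_Icc_add,
      ← Nat.mul_factorial_pred (Nat.cast_pos.1 hm0).ne']
    push_cast
    ring
  have hden : ∀ j ∈ (Icc 1 D).erase m,
      |(j : ℝ) ^ 2 - (m : ℝ) ^ 2| = |(j : ℝ) - m| * (j + m) := fun j _ => by
    rw [sq_sub_sq, abs_mul, abs_of_nonneg (by positivity : (0 : ℝ) ≤ j + m), mul_comm]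
  rw [prod_div_distrib, prod_pow, prod_congr rfl hden, prod_mul_distrib,
    prod_erase_Icc_abs_sub hm, ← hadd, ← hnum]
  have hprod : ∏ j ∈ (Icc 1 D).erase m, ((j : ℝ) + m) ≠ 0 :=
    prod_ne_zero_iff.2 fun j _ => by positivity
  field_simp

theorem sq_factorial_le_factorial_sub_mul_factorial_add {m D : ℕ} (hD : m ≤ D) :
    D ! ^ 2 ≤ (D - m)! * (D + m)! := by
  calc D ! ^ 2 = (D - m)! * D.descFactorial m * D ! := by
        rw [Nat.factorial_mul_descFactorial hD, sq]
    _ ≤ (D - m)! * (D + 1) ^ m * D ! := by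
        gcongr
        exact (Nat.descFactorial_le_pow D m).trans (Nat.pow_le_pow_left D.le_succ m)
    _ = (D - m)! * (D ! * (D + 1) ^ m) := by ring
    _ ≤ (D - m)! * (D + m)! := by gcongr; exact Nat.factorial_mul_pow_le_factorial

theorem prod_erase_Icc_sq_div_abs_sq_sub_sq_le_two {m D : ℕ} (hm : m ∈ Icc 1 D) :
    ∏ j ∈ (Icc 1 D).erase m, (j : ℝ) ^ 2 / |(j : ℝ) ^ 2 - (m : ℝ) ^ 2| ≤ 2 := by
  rw [prod_erase_Icc_sq_div_abs_sq_sub_sq hm, div_le_iff₀ (by positivity)]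
  gcongr
  exact_mod_cast sq_factorial_le_factorial_sub_mul_factorial_add (mem_Icc.1 hm).2

end FactorialProducts

section QuadraticGrowth

open Finset

variable {D : ℕ} {y : ℕ → ℝ}

theorem div_abs_sub_le_div_abs_sub {a b c d : ℝ} (ha : 0 < a) (hc : 0 < c) (hd : 0 < d)
    (hcd : c ≠ d) (h₁ : d < c → b / d ≤ a / c) (h₂ : c < d → a / c ≤ b / d) :
    a / |a - b| ≤ c / |c - d| := by
  have hcd' : 0 < |c - d| := abs_pos.2 (sub_ne_zero.2 hcd)
  have hmul : a * |c - d| ≤ c * |a - b| := by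
    rcases hcd.lt_or_gt with h | h
    · have := (div_le_div_iff₀ hc hd).1 (h₂ h)
      rw [abs_of_neg (sub_neg.2 h)]
      nlinarith [neg_le_abs (a - b)]
    · have := (div_le_div_iff₀ hd hc).1 (h₁ h)
      rw [abs_of_pos (sub_pos.2 h)]
      nlinarith [le_abs_self (a - b)]
  have hab : 0 < |a - b| := pos_of_mul_pos_right ((mul_pos ha hcd').trans_le hmul) hc.le
  rwa [div_le_div_iff₀ hab hcd']

theorem prod_erase_Icc_div_abs_sub_le_two (hy : ∀ i ∈ Icc 1 D, 0 < y i)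
    (hmono : MonotoneOn (fun i : ℕ => y i / (i : ℝ) ^ 2) (Icc 1 D : Finset ℕ))
    {m : ℕ} (hm : m ∈ Icc 1 D) : ∏ j ∈ (Icc 1 D).erase m, y j / |y j - y m| ≤ 2 := by
  refine (prod_le_prod (fun j hj => ?_) fun j hj => ?_).trans
    (prod_erase_Icc_sq_div_abs_sq_sub_sq_le_two hm)
  · exact div_nonneg (hy j (mem_of_mem_erase hj)).le (abs_nonneg _)
  obtain ⟨hne, hj⟩ := mem_erase.1 hj
  have hj0 : (0 : ℝ) < j := Nat.cast_pos.2 (mem_Icc.1 hj).1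
  have hm0 : (0 : ℝ) < m := Nat.cast_pos.2 (mem_Icc.1 hm).1
  have hlt {i k : ℕ} (h : (i : ℝ) ^ 2 < (k : ℝ) ^ 2) : i ≤ k :=
    Nat.cast_le.1 (lt_of_pow_lt_pow_left₀ 2 k.cast_nonneg h).le
  refine div_abs_sub_le_div_abs_sub (hy j hj) (by positivity) (by positivity) ?_
    (fun h => hmono hm hj (hlt h)) fun h => hmono hj hm (hlt h)
  exact fun h => hne (Nat.cast_injective ((pow_left_inj₀ hj0.le hm0.le two_ne_zero).1 h))

theorem strictMonoOn_Icc_of_monotoneOn_div_sq (hy : ∀ i ∈ Icc 1 D, 0 < y i)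
    (hmono : MonotoneOn (fun i : ℕ => y i / (i : ℝ) ^ 2) (Icc 1 D : Finset ℕ)) :
    StrictMonoOn y (Icc 1 D : Finset ℕ) := by
  intro i hi j hj hij
  have hi0 : (0 : ℝ) < i := Nat.cast_pos.2 (mem_Icc.1 hi).1
  have hij' : (i : ℝ) ^ 2 < (j : ℝ) ^ 2 := by gcongr
  have hyi := hy i hi
  calc y i = y i / (i : ℝ) ^ 2 * (i : ℝ) ^ 2 := by field_simp
    _ < y i / (i : ℝ) ^ 2 * (j : ℝ) ^ 2 := by gcongr
    _ ≤ y j / (j : ℝ) ^ 2 * (j : ℝ) ^ 2 :=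
        mul_le_mul_of_nonneg_right (hmono hi hj hij.le) (by positivity)
    _ = y j := by have := hi0.trans (Nat.cast_lt.2 hij); field_simp

theorem sum_Icc_inv_sq_le_two (n : ℕ) : ∑ i ∈ Icc 1 n, ((i : ℝ) ^ 2)⁻¹ ≤ 2 := by
  have hIcc : Icc 1 n = Ioo 0 (n + 1) := by
    ext i
    simp only [mem_Icc, mem_Ioo]
    omega
  simpa [hIcc] using sum_Ioo_inv_sq_le (α := ℝ) 0 (n + 1)

end QuadraticGrowth

section LaurentInterpolation

open Polynomial Finset

variable {ι F : Type*} [DecidableEq ι]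

theorem eval_eq_sum_lagrange [Field F] {s : Finset ι} {x : ι → F} (hx : Set.InjOn x s) {P : F[X]}
    (hP : P.degree < #s) (a : F) :
    P.eval a = ∑ i ∈ s, P.eval (x i) * ∏ j ∈ s.erase i, (a - x j) / (x i - x j) := by
  conv_lhs => rw [Lagrange.eq_interpolate hx hP, Lagrange.interpolate_apply, eval_finsetSum]
  refine sum_congr rfl fun i _ => ?_
  rw [eval_mul, eval_C, Lagrange.basis, eval_prod]
  refine congrArg _ (prod_congr rfl fun j _ => ?_)
  rw [Lagrange.basisDivisor, eval_mul, eval_C, eval_sub, eval_X, eval_C, inv_mul_eq_div]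

theorem eval_eq_sum_lagrange_of_isRoot [Field F] {s : Finset ι} {x : ι → F} (hx : Set.InjOn x s)
    {P : F[X]} (hP : P.natDegree ≤ #s) {b : F} (hb : P.IsRoot b) (hxb : ∀ i ∈ s, x i ≠ b)
    (a : F) :
    P.eval a = ∑ i ∈ s, P.eval (x i) * ((a - b) / (x i - b)) *
      ∏ j ∈ s.erase i, (a - x j) / (x i - x j) := by
  rcases eq_or_ne P 0 with rfl | hP0
  · simp
  obtain ⟨H, rfl⟩ := dvd_iff_isRoot.2 hb
  have hH : H.degree < #s := by
    have hH0 : H ≠ 0 := right_ne_zero_of_mul hP0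
    rw [natDegree_mul (X_sub_C_ne_zero b) hH0, natDegree_X_sub_C] at hP
    rw [degree_eq_natDegree hH0]
    exact_mod_cast (by omega : H.natDegree < #s)
  simp only [eval_mul, eval_sub, eval_X, eval_C]
  rw [eval_eq_sum_lagrange hx hH a, mul_sum]
  refine sum_congr rfl fun i hi => ?_
  have := sub_ne_zero.2 (hxb i hi)
  field_simp

/-- When `z ↦ z ^ n * (f z - f b)` agrees with a polynomial of degree at most `#s`, Lagrange
interpolation writes `f a - f b` as a linear combination of the differences `f (x i) - f b` with
`i ∈ s`. This is the absolute value of the coefficient of `f (x i) - f b`. -/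
noncomputable def laurentWeight (n : ℕ) (s : Finset ι) (x : ι → ℝ) (a b : ℝ) (i : ι) : ℝ :=
  |x i / a| ^ n * |(a - b) / (x i - b)| * ∏ j ∈ s.erase i, |(a - x j) / (x i - x j)|

theorem abs_sub_le_sum_laurentWeight {n : ℕ} {s : Finset ι} {x : ι → ℝ} (hx : Set.InjOn x s)
    {P : ℝ[X]} (hP : P.natDegree ≤ #s) (hn : n ≤ #s) {a b : ℝ} (ha : a ≠ 0)
    (hxb : ∀ i ∈ s, x i ≠ b) {y : ι → ℝ} {ya yb M : ℝ} (hy : ∀ i ∈ s, x i ^ n * y i = P.eval (x i))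
    (hya : a ^ n * ya = P.eval a) (hyb : b ^ n * yb = P.eval b) (hM : ∀ i ∈ s, |y i - yb| ≤ M) :
    |ya - yb| ≤ M * ∑ i ∈ s, laurentWeight n s x a b i := by
  set G : ℝ[X] := P - C yb * X ^ n with hG
  have hGdeg : G.natDegree ≤ #s :=
    natDegree_sub_le_of_le hP ((natDegree_C_mul_X_pow_le _ _).trans hn) |>.trans_eq (max_self _)
  have hG_eval {z yz : ℝ} (hyz : z ^ n * yz = P.eval z) : G.eval z = z ^ n * (yz - yb) := by
    simp only [hG, eval_sub, eval_mul, eval_C, eval_pow, eval_X, ← hyz]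
    ring
  have hGb : G.IsRoot b := by rw [IsRoot, hG_eval hyb, sub_self, mul_zero]
  have hdiff : ya - yb = ∑ i ∈ s, (y i - yb) * ((x i / a) ^ n * ((a - b) / (x i - b)) *
      ∏ j ∈ s.erase i, (a - x j) / (x i - x j)) := by
    refine mul_left_cancel₀ (pow_ne_zero n ha) ?_
    rw [← hG_eval hya, eval_eq_sum_lagrange_of_isRoot hx hGdeg hGb hxb, mul_sum]
    refine sum_congr rfl fun i hi => ?_
    rw [hG_eval (hy i hi), div_pow]
    field_simp
  rw [hdiff, mul_sum]
  refine (abs_sum_le_sum_abs _ _).trans (sum_le_sum fun i hi => ?_)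
  rw [abs_mul, abs_mul, abs_mul, abs_pow, abs_prod, ← laurentWeight]
  gcongr
  · unfold laurentWeight; positivity
  · exact hM i hi

end LaurentInterpolation

section TwoFamilies

open Finset

variable {ι κ : Type*} [DecidableEq ι] [DecidableEq κ] {s : Finset ι} {t : Finset κ}

theorem disjSum_erase_inl (s : Finset ι) (t : Finset κ) (m : ι) :
    (s.disjSum t).erase (.inl m) = (s.erase m).disjSum t := by
  ext (i | k) <;> simp

theorem disjSum_erase_inr (s : Finset ι) (t : Finset κ) (m : κ) :
    (s.disjSum t).erase (.inr m) = s.disjSum (t.erase m) := by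
  ext (i | k) <;> simp

variable {u : ι → ℝ} {v : κ → ℝ} {a : ℝ}

theorem laurentWeight_inl_le (hu : ∀ i ∈ s, 0 < u i) (hua : ∀ i ∈ s, u i ≤ a)
    (hav : ∀ k ∈ t, a ≤ v k) (b : ℝ) {m : ι} (hm : m ∈ s) :
    laurentWeight #s (s.disjSum t) (Sum.elim u v) a b (.inl m) ≤
      u m / a * |(a - b) / (u m - b)| * ∏ i ∈ s.erase m, u m / |u m - u i| := by
  have hum := hu m hm
  have ha : 0 < a := hum.trans_le (hua m hm)
  have hlow : ∀ i ∈ s.erase m, |u m / a| * |(a - u i) / (u m - u i)| ≤ u m / |u m - u i| :=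
    fun i hi => by
      have hi' := mem_of_mem_erase hi
      rw [abs_div (a - u i), abs_of_pos (div_pos hum ha),
        abs_of_nonneg (sub_nonneg.2 (hua i hi')), div_mul_div_comm, ← div_div]
      gcongr
      rw [div_le_iff₀ ha]
      gcongr
      linarith [hu i hi']
  have hhigh : ∀ k ∈ t, |(a - v k) / (u m - v k)| ≤ 1 := fun k hk => by
    rw [abs_div, abs_sub_comm, abs_sub_comm (u m), abs_of_nonneg (sub_nonneg.2 (hav k hk)),
      abs_of_nonneg (sub_nonneg.2 ((hua m hm).trans (hav k hk)))]
    exact div_le_one_of_le₀ (sub_le_sub_left (hua m hm) _)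
      (sub_nonneg.2 ((hua m hm).trans (hav k hk)))
  have hpow : |u m / a| ^ #s = u m / a * ∏ _i ∈ s.erase m, |u m / a| := by
    rw [prod_const, ← card_erase_add_one hm, pow_succ', abs_of_pos (div_pos hum ha)]
  calc laurentWeight #s (s.disjSum t) (Sum.elim u v) a b (.inl m)
      = u m / a * |(a - b) / (u m - b)| *
          (∏ i ∈ s.erase m, |u m / a| * |(a - u i) / (u m - u i)|) *
          ∏ k ∈ t, |(a - v k) / (u m - v k)| := by
        simp only [laurentWeight, disjSum_erase_inl, prod_disjSum, Sum.elim_inl, Sum.elim_inr,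
          hpow, prod_mul_distrib]
        ring
    _ ≤ u m / a * |(a - b) / (u m - b)| * (∏ i ∈ s.erase m, u m / |u m - u i|) * 1 := by
        gcongr
        · exact hlow _ ‹_›
        · exact prod_le_one (fun k _ => abs_nonneg _) hhigh
    _ = _ := mul_one _

theorem laurentWeight_inr_le (ha : 0 < a) (hu : ∀ i ∈ s, 0 ≤ u i) (hua : ∀ i ∈ s, u i ≤ a)
    (hav : ∀ k ∈ t, a ≤ v k) (b : ℝ) {m : κ} (hm : m ∈ t) :
    laurentWeight #s (s.disjSum t) (Sum.elim u v) a b (.inr m) ≤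
      |(a - b) / (v m - b)| * ∏ k ∈ t.erase m, v k / |v m - v k| := by
  have hvm := hav m hm
  have hlow : ∀ i ∈ s, |v m / a| * |(a - u i) / (v m - u i)| ≤ 1 := fun i hi => by
    have hui := hua i hi
    rw [abs_div (a - u i), abs_of_pos (div_pos (ha.trans_le hvm) ha),
      abs_of_nonneg (sub_nonneg.2 hui), abs_of_nonneg (sub_nonneg.2 (hui.trans hvm)),
      div_mul_div_comm]
    refine div_le_one_of_le₀ ?_ (mul_nonneg ha.le (sub_nonneg.2 (hui.trans hvm)))
    nlinarith [mul_le_mul_of_nonneg_right hvm (hu i hi)]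
  have hhigh : ∀ k ∈ t.erase m, |(a - v k) / (v m - v k)| ≤ v k / |v m - v k| := fun k hk => by
    have hvk := hav k (mem_of_mem_erase hk)
    rw [abs_div, abs_sub_comm, abs_of_nonneg (sub_nonneg.2 hvk)]
    gcongr
    linarith
  calc laurentWeight #s (s.disjSum t) (Sum.elim u v) a b (.inr m)
      = |(a - b) / (v m - b)| * (∏ i ∈ s, |v m / a| * |(a - u i) / (v m - u i)|) *
          ∏ k ∈ t.erase m, |(a - v k) / (v m - v k)| := by
        simp only [laurentWeight, disjSum_erase_inr, prod_disjSum, Sum.elim_inl, Sum.elim_inr,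
          prod_mul_distrib, prod_const]
        ring
    _ ≤ |(a - b) / (v m - b)| * 1 * ∏ k ∈ t.erase m, v k / |v m - v k| := by
        gcongr
        · exact prod_le_one (fun i _ => by positivity) hlow
        · exact hhigh _ ‹_›
    _ = _ := by rw [mul_one]

end TwoFamilies

section Nodes

open Finset

variable {N w E D i : ℕ}

/-- The interpolation nodes below `w`, an integral version of `2 * E ^ 3 / i ^ 2`. Subtracting `i`
makes `i ^ 2 * lowNode E i` nonincreasing in `i` in spite of the rounding. -/
def lowNode (E i : ℕ) : ℕ := 2 * E ^ 3 / i ^ 2 - i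

/-- The interpolation nodes above `2 * w`, an integral version of `N * i ^ 2 / D ^ 2` which is an
exact multiple of `i ^ 2`. -/
def highNode (N D i : ℕ) : ℕ := N / D ^ 2 * i ^ 2

theorem lowNode_pos (hi : i ∈ Icc 1 E) : 0 < lowNode E i := by
  obtain ⟨h1, hE⟩ := mem_Icc.1 hi
  have : 2 * E ≤ 2 * E ^ 3 / i ^ 2 := by
    rw [Nat.le_div_iff_mul_le (by positivity)]
    calc 2 * E * i ^ 2 ≤ 2 * E * E ^ 2 := by gcongr
      _ = 2 * E ^ 3 := by ring
  unfold lowNode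
  omega

theorem sq_mul_lowNode_le (E i : ℕ) : i ^ 2 * lowNode E i ≤ 2 * E ^ 3 :=
  (Nat.mul_le_mul_left _ (Nat.sub_le _ _)).trans (Nat.mul_div_le _ _)

theorem lowNode_lt (hi : i ∈ Icc 1 E) (hw : 2 * E ^ 3 < w) : lowNode E i < w :=
  (Nat.le_mul_of_pos_left _ (pow_pos (mem_Icc.1 hi).1 2)).trans_lt
    ((sq_mul_lowNode_le E i).trans_lt hw)

theorem sq_mul_lowNode_antitoneOn (E : ℕ) :
    AntitoneOn (fun i => i ^ 2 * lowNode E i) (Icc 1 E : Finset ℕ) := by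
  intro i hi j hj hij
  rcases hij.eq_or_lt with rfl | hlt
  · rfl
  have hi0 : 0 < i ^ 2 := pow_pos (mem_Icc.1 hi).1 2
  have hlow : i ^ 2 * (2 * E ^ 3 / i ^ 2) + i ^ 2 > 2 * E ^ 3 := by
    rw [← Nat.mul_succ]
    exact Nat.lt_mul_div_succ _ hi0
  have hup : j ^ 2 * (2 * E ^ 3 / j ^ 2) ≤ 2 * E ^ 3 := Nat.mul_div_le _ _
  have hcube : i ^ 3 + i ^ 2 ≤ j ^ 3 := by
    calc i ^ 3 + i ^ 2 ≤ (i + 1) ^ 3 := by nlinarith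
      _ ≤ j ^ 3 := by gcongr; exact hlt
  simp only [lowNode, Nat.mul_sub, ← pow_succ, Nat.reduceAdd]
  omega

theorem highNode_le (hi : i ∈ Icc 1 D) : highNode N D i ≤ N := by
  calc N / D ^ 2 * i ^ 2 ≤ N / D ^ 2 * D ^ 2 := by gcongr; exact (mem_Icc.1 hi).2
    _ ≤ N := Nat.div_mul_le_self _ _

theorem four_mul_le_highNode (hi : i ∈ Icc 1 D) (hN : 4 * D ^ 2 * w ≤ N) :
    4 * w ≤ highNode N D i := by
  obtain ⟨h1, hD⟩ := mem_Icc.1 hi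
  refine le_trans ?_ (Nat.le_mul_of_pos_right _ (pow_pos h1 2))
  rw [Nat.le_div_iff_mul_le (pow_pos (h1.trans hD) 2)]
  linarith

theorem mul_sq_le_highNode (hD : 0 < D) (hN : D ^ 2 ≤ N) (i : ℕ) :
    N * i ^ 2 ≤ 2 * D ^ 2 * highNode N D i := by
  have hD2 : 0 < D ^ 2 := pow_pos hD 2
  have hk : 1 ≤ N / D ^ 2 := (Nat.one_le_div_iff hD2).2 hN
  have hlt : N < D ^ 2 * (N / D ^ 2 + 1) := Nat.lt_mul_div_succ _ hD2
  calc N * i ^ 2 ≤ D ^ 2 * (N / D ^ 2 + N / D ^ 2) * i ^ 2 := by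
        gcongr
        exact hlt.le.trans (by gcongr)
    _ = 2 * D ^ 2 * highNode N D i := by unfold highNode; ring

end Nodes

section IntegerNodes

open Polynomial Finset

variable {N w E D m : ℕ}

theorem monotoneOn_inv_lowNode_div_sq (E : ℕ) :
    MonotoneOn (fun i : ℕ => (lowNode E i : ℝ)⁻¹ / (i : ℝ) ^ 2) (Icc 1 E : Finset ℕ) := by
  intro i hi j hj hij
  have hj0 : 0 < j ^ 2 * lowNode E j := mul_pos (pow_pos (mem_Icc.1 hj).1 2) (lowNode_pos hj)
  have hanti := inv_anti₀ (Nat.cast_pos (α := ℝ).2 hj0)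
    (Nat.cast_le.2 (sq_mul_lowNode_antitoneOn E hi hj hij))
  simpa only [div_eq_inv_mul, ← mul_inv, Nat.cast_mul, Nat.cast_pow] using hanti

theorem inv_lowNode_pos : ∀ i ∈ Icc 1 E, (0 : ℝ) < (lowNode E i : ℝ)⁻¹ :=
  fun _ hi => inv_pos.2 (Nat.cast_pos.2 (lowNode_pos hi))

theorem injOn_lowNode (E : ℕ) : Set.InjOn (fun i => (lowNode E i : ℝ)) (Icc 1 E : Finset ℕ) :=
  fun _ hi _ hj hij => (strictMonoOn_Icc_of_monotoneOn_div_sq inv_lowNode_pos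
    (monotoneOn_inv_lowNode_div_sq E)).injOn hi hj (congrArg (·⁻¹) hij)

theorem prod_erase_lowNode_div_abs_sub_le_two (hm : m ∈ Icc 1 E) :
    ∏ i ∈ (Icc 1 E).erase m, (lowNode E m : ℝ) / |(lowNode E m : ℝ) - lowNode E i| ≤ 2 := by
  refine le_of_eq_of_le (prod_congr rfl fun i hi => ?_)
    (prod_erase_Icc_div_abs_sub_le_two inv_lowNode_pos (monotoneOn_inv_lowNode_div_sq E) hm)
  have hi0 : (0 : ℝ) < lowNode E i := Nat.cast_pos.2 (lowNode_pos (mem_of_mem_erase hi))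
  have hm0 : (0 : ℝ) < lowNode E m := Nat.cast_pos.2 (lowNode_pos hm)
  rw [inv_sub_inv hi0.ne' hm0.ne', abs_div, abs_of_pos (mul_pos hi0 hm0)]
  field_simp

theorem monotoneOn_highNode_div_sq (N D : ℕ) :
    MonotoneOn (fun i : ℕ => (highNode N D i : ℝ) / (i : ℝ) ^ 2) (Icc 1 D : Finset ℕ) := by
  have hconst : ∀ i ∈ Icc 1 D, (highNode N D i : ℝ) / (i : ℝ) ^ 2 = (N / D ^ 2 : ℕ) := by
    intro i hi
    have hi0 : (i : ℝ) ≠ 0 := Nat.cast_ne_zero.2 (Nat.one_le_iff_ne_zero.1 (mem_Icc.1 hi).1)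
    rw [highNode, Nat.cast_mul, Nat.cast_pow, mul_div_cancel_right₀ _ (pow_ne_zero 2 hi0)]
  exact fun i hi j hj _ => ((hconst i hi).trans (hconst j hj).symm).le

theorem highNode_pos (hN : D ^ 2 ≤ N) : ∀ i ∈ Icc 1 D, (0 : ℝ) < highNode N D i := fun i hi => by
  obtain ⟨h1, hD⟩ := mem_Icc.1 hi
  exact Nat.cast_pos.2 (mul_pos (Nat.div_pos hN (pow_pos (h1.trans hD) 2)) (pow_pos h1 2))

theorem injOn_highNode (hN : D ^ 2 ≤ N) :
    Set.InjOn (fun i => (highNode N D i : ℝ)) (Icc 1 D : Finset ℕ) :=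
  (strictMonoOn_Icc_of_monotoneOn_div_sq (highNode_pos hN) (monotoneOn_highNode_div_sq N D)).injOn

theorem prod_erase_highNode_div_abs_sub_le_two (hN : D ^ 2 ≤ N) (hm : m ∈ Icc 1 D) :
    ∏ i ∈ (Icc 1 D).erase m,
      (highNode N D i : ℝ) / |(highNode N D m : ℝ) - highNode N D i| ≤ 2 := by
  simpa only [abs_sub_comm] using prod_erase_Icc_div_abs_sub_le_two (highNode_pos hN)
    (monotoneOn_highNode_div_sq N D) hm

/-- The interpolation nodes around `w` and `2 * w`, the low ones indexed by the left summand. -/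
def laurentNode (N E D : ℕ) : ℕ ⊕ ℕ → ℕ := Sum.elim (lowNode E) (highNode N D)

theorem cast_laurentNode (N E D : ℕ) : (fun i => (laurentNode N E D i : ℝ)) =
    Sum.elim (fun i => (lowNode E i : ℝ)) (fun i => (highNode N D i : ℝ)) := by
  ext (i | i) <;> rfl

theorem laurentNode_mem_Icc (hw : 2 * w ≤ N) (hE : 2 * E ^ 3 < w) (hN : 4 * D ^ 2 * w ≤ N)
    {i : ℕ ⊕ ℕ} (hi : i ∈ (Icc 1 E).disjSum (Icc 1 D)) : laurentNode N E D i ∈ Icc 1 N := by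
  rw [mem_Icc]
  rcases i with i | i
  · have hi' := inl_mem_disjSum.1 hi
    exact ⟨lowNode_pos hi', (lowNode_lt hi' hE).le.trans (by omega)⟩
  · have hi' := inr_mem_disjSum.1 hi
    exact ⟨le_trans (by omega) (four_mul_le_highNode hi' hN), highNode_le hi'⟩

theorem injOn_laurentNode (hE : 2 * E ^ 3 < w) (hN : 4 * D ^ 2 * w ≤ N) :
    Set.InjOn (fun i => (laurentNode N E D i : ℝ)) ((Icc 1 E).disjSum (Icc 1 D) : Finset _) := by
  have hw : 0 < w := by omega
  have hDN : D ^ 2 ≤ N := by nlinarith [Nat.mul_le_mul_left (D ^ 2) hw]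
  have hlt {i j : ℕ} (hi : i ∈ Icc 1 E) (hj : j ∈ Icc 1 D) :
      (lowNode E i : ℝ) < highNode N D j :=
    Nat.cast_lt.2 ((lowNode_lt hi hE).trans_le
      ((Nat.le_mul_of_pos_left w four_pos).trans (four_mul_le_highNode hj hN)))
  rintro (i | i) hi (j | j) hj hij <;>
    simp only [mem_coe, inl_mem_disjSum, inr_mem_disjSum] at hi hj
  · exact congrArg _ (injOn_lowNode E hi hj hij)
  · exact absurd hij (hlt hi hj).ne
  · exact absurd hij (hlt hj hi).ne'
  · exact congrArg _ (injOn_highNode hDN hi hj hij)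

theorem laurentNode_ne_two_mul (hE : 2 * E ^ 3 < w) (hN : 4 * D ^ 2 * w ≤ N) :
    ∀ i ∈ (Icc 1 E).disjSum (Icc 1 D), (laurentNode N E D i : ℝ) ≠ 2 * w := by
  rintro (i | i) hi <;> norm_cast
  · exact ((lowNode_lt (inl_mem_disjSum.1 hi) hE).trans_le (Nat.le_mul_of_pos_left w two_pos)).ne
  · exact (lt_of_lt_of_le (by omega) (four_mul_le_highNode (inr_mem_disjSum.1 hi) hN)).ne'

theorem laurentWeight_laurentNode_inl_le (hE : 2 * E ^ 3 < w) (hN : 4 * D ^ 2 * w ≤ N)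
    (hm : m ∈ Icc 1 E) :
    laurentWeight E ((Icc 1 E).disjSum (Icc 1 D)) (fun i => laurentNode N E D i) w (2 * w)
      (.inl m) ≤ 4 * (E : ℝ) ^ 3 / w * ((m : ℝ) ^ 2)⁻¹ := by
  have hw : (0 : ℝ) < w := Nat.cast_pos.2 (by omega)
  have hm0 : (0 : ℝ) < m := Nat.cast_pos.2 (mem_Icc.1 hm).1
  have hlt : ∀ i ∈ Icc 1 E, (lowNode E i : ℝ) < w := fun i hi => Nat.cast_lt.2 (lowNode_lt hi hE)
  have hweight := laurentWeight_inl_le (t := Icc 1 D) (v := fun i => (highNode N D i : ℝ))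
    (fun i hi => Nat.cast_pos.2 (lowNode_pos hi)) (fun i hi => (hlt i hi).le)
    (fun i hi => Nat.cast_le.2 (by have := four_mul_le_highNode hi hN; omega)) (2 * w : ℝ) hm
  rw [Nat.card_Icc, add_tsub_cancel_right, ← cast_laurentNode] at hweight
  have hnode : (lowNode E m : ℝ) ≤ 2 * (E : ℝ) ^ 3 / (m : ℝ) ^ 2 := by
    rw [le_div_iff₀' (by positivity)]
    exact_mod_cast sq_mul_lowNode_le E m
  have hratio : |((w : ℝ) - 2 * w) / (lowNode E m - 2 * w)| ≤ 1 := by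
    have := hlt m hm
    rw [abs_div, abs_of_neg (by linarith), abs_of_neg (by linarith)]
    exact div_le_one_of_le₀ (by linarith) (by linarith)
  refine hweight.trans ?_
  calc _ ≤ 2 * (E : ℝ) ^ 3 / (m : ℝ) ^ 2 / w * 1 * 2 := by
        gcongr
        exact prod_erase_lowNode_div_abs_sub_le_two hm
    _ = 4 * (E : ℝ) ^ 3 / w * ((m : ℝ) ^ 2)⁻¹ := by ring

theorem laurentWeight_laurentNode_inr_le (hE : 2 * E ^ 3 < w) (hN : 4 * D ^ 2 * w ≤ N)
    (hm : m ∈ Icc 1 D) :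
    laurentWeight E ((Icc 1 E).disjSum (Icc 1 D)) (fun i => laurentNode N E D i) w (2 * w)
      (.inr m) ≤ 8 * (D : ℝ) ^ 2 * w / N * ((m : ℝ) ^ 2)⁻¹ := by
  have hw' : 0 < w := by omega
  have hDN : D ^ 2 ≤ N := by nlinarith [Nat.mul_le_mul_left (D ^ 2) hw']
  have hw : (0 : ℝ) < w := Nat.cast_pos.2 hw'
  obtain ⟨hm1, hmD⟩ := mem_Icc.1 hm
  have := Nat.cast_pos (α := ℝ).2 hm1
  have hfour : ∀ i ∈ Icc 1 D, 4 * (w : ℝ) ≤ highNode N D i := fun i hi => by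
    exact_mod_cast four_mul_le_highNode hi hN
  have hweight := laurentWeight_inr_le (s := Icc 1 E) (u := fun i => (lowNode E i : ℝ)) hw
    (fun i _ => Nat.cast_nonneg _) (fun i hi => Nat.cast_le.2 (lowNode_lt hi hE).le)
    (fun i hi => by linarith [hfour i hi]) (2 * w : ℝ) hm
  rw [Nat.card_Icc, add_tsub_cancel_right, ← cast_laurentNode] at hweight
  have hN0 : (0 : ℝ) < N := Nat.cast_pos.2 ((pow_pos (hm1.trans hmD) 2).trans_le hDN)
  have hnode : (N : ℝ) * (m : ℝ) ^ 2 ≤ 2 * (D : ℝ) ^ 2 * highNode N D m := by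
    exact_mod_cast mul_sq_le_highNode (hm1.trans hmD) hDN m
  have hratio : |((w : ℝ) - 2 * w) / (highNode N D m - 2 * w)| ≤
      4 * (D : ℝ) ^ 2 * w / (N * (m : ℝ) ^ 2) := by
    have hwm := hfour m hm
    have hgap : (N : ℝ) * (m : ℝ) ^ 2 ≤ 4 * (D : ℝ) ^ 2 * (highNode N D m - 2 * w) := by
      nlinarith [mul_nonneg (sq_nonneg (D : ℝ)) (sub_nonneg.2 hwm)]
    rw [abs_div, abs_of_neg (by linarith), abs_of_pos (by linarith),
      div_le_div_iff₀ (by linarith) (by positivity)]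
    linarith [mul_le_mul_of_nonneg_left hgap hw.le]
  refine hweight.trans ?_
  calc _ ≤ 4 * (D : ℝ) ^ 2 * w / (N * (m : ℝ) ^ 2) * 2 := by
        gcongr
        exact prod_erase_highNode_div_abs_sub_le_two hDN hm
    _ = 8 * (D : ℝ) ^ 2 * w / N * ((m : ℝ) ^ 2)⁻¹ := by field_simp; ring

theorem sum_laurentWeight_laurentNode_le (hE : 2 * E ^ 3 < w) (hN : 4 * D ^ 2 * w ≤ N) :
    ∑ i ∈ (Icc 1 E).disjSum (Icc 1 D), laurentWeight E ((Icc 1 E).disjSum (Icc 1 D))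
      (fun i => laurentNode N E D i) w (2 * w) i ≤
      8 * (E : ℝ) ^ 3 / w + 16 * (D : ℝ) ^ 2 * w / N := by
  rw [sum_disjSum]
  calc _ ≤ ∑ m ∈ Icc 1 E, 4 * (E : ℝ) ^ 3 / w * ((m : ℝ) ^ 2)⁻¹ +
        ∑ m ∈ Icc 1 D, 8 * (D : ℝ) ^ 2 * w / N * ((m : ℝ) ^ 2)⁻¹ :=
        add_le_add (sum_le_sum fun m => laurentWeight_laurentNode_inl_le hE hN)
          (sum_le_sum fun m => laurentWeight_laurentNode_inr_le hE hN)
    _ ≤ 4 * (E : ℝ) ^ 3 / w * 2 + 8 * (D : ℝ) ^ 2 * w / N * 2 := by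
        rw [← mul_sum, ← mul_sum]
        gcongr <;> exact sum_Icc_inv_sq_le_two _
    _ = 8 * (E : ℝ) ^ 3 / w + 16 * (D : ℝ) ^ 2 * w / N := by ring

variable {P : ℝ[X]} {q : ℕ → ℝ}

theorem abs_sub_le_of_pow_mul_eq_eval_of_lt (hwN : 2 * w ≤ N) (hE : 2 * E ^ 3 < w)
    (hN : 4 * D ^ 2 * w ≤ N) (hP : P.natDegree ≤ E + D)
    (hPq : ∀ k ∈ Icc 1 N, (k : ℝ) ^ E * q k = P.eval (k : ℝ))
    (hq : ∀ k ∈ Icc 1 N, q k ∈ Set.Icc 0 1) :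
    |q w - q (2 * w)| ≤ 8 * (E : ℝ) ^ 3 / w + 16 * (D : ℝ) ^ 2 * w / N := by
  have hw : 0 < w := by omega
  have h2w : 2 * w ∈ Icc 1 N := mem_Icc.2 (by omega)
  have hcard : #((Icc 1 E).disjSum (Icc 1 D)) = E + D := by
    rw [card_disjSum, Nat.card_Icc, Nat.card_Icc, add_tsub_cancel_right, add_tsub_cancel_right]
  have hmem := fun i => laurentNode_mem_Icc (i := i) hwN hE hN
  calc |q w - q (2 * w)|
      ≤ 1 * ∑ i ∈ (Icc 1 E).disjSum (Icc 1 D), laurentWeight E ((Icc 1 E).disjSum (Icc 1 D))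
          (fun i => laurentNode N E D i) w (2 * w) i :=
        abs_sub_le_sum_laurentWeight (injOn_laurentNode hE hN) (hP.trans_eq hcard.symm)
          (hcard.symm ▸ Nat.le_add_right E D) (Nat.cast_pos.2 hw).ne'
          (laurentNode_ne_two_mul hE hN) (fun i hi => hPq _ (hmem i hi))
          (hPq w (mem_Icc.2 (by omega))) (by simpa using hPq _ h2w)
          fun i hi => Real.dist_le_of_mem_Icc_01 (hq _ (hmem i hi)) (hq _ h2w)
    _ ≤ _ := by rw [one_mul]; exact sum_laurentWeight_laurentNode_le hE hN

theorem abs_sub_le_of_pow_mul_eq_eval (hw : 0 < w) (hwN : 2 * w ≤ N) (hP : P.natDegree ≤ E + D)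
    (hPq : ∀ k ∈ Icc 1 N, (k : ℝ) ^ E * q k = P.eval (k : ℝ))
    (hq : ∀ k ∈ Icc 1 N, q k ∈ Set.Icc 0 1) :
    |q w - q (2 * w)| ≤ 8 * (E : ℝ) ^ 3 / w + 16 * (D : ℝ) ^ 2 * w / N := by
  have hw0 : (0 : ℝ) < w := Nat.cast_pos.2 hw
  have hN0 : (0 : ℝ) < N := Nat.cast_pos.2 (by omega)
  have hone : |q w - q (2 * w)| ≤ 1 :=
    Real.dist_le_of_mem_Icc_01 (hq _ (mem_Icc.2 (by omega))) (hq _ (mem_Icc.2 (by omega)))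
  rcases le_or_gt w (2 * E ^ 3) with hE | hE
  · have hE' : (w : ℝ) ≤ 2 * (E : ℝ) ^ 3 := by exact_mod_cast hE
    calc |q w - q (2 * w)| ≤ 1 := hone
      _ ≤ 8 * (E : ℝ) ^ 3 / w := by rw [le_div_iff₀ hw0]; linarith
      _ ≤ _ := le_add_of_nonneg_right (by positivity)
  rcases le_or_gt N (4 * D ^ 2 * w) with hN | hN
  · have hN' : (N : ℝ) ≤ 4 * (D : ℝ) ^ 2 * w := by exact_mod_cast hN
    calc |q w - q (2 * w)| ≤ 1 := hone
      _ ≤ 16 * (D : ℝ) ^ 2 * w / N := by rw [le_div_iff₀ hN0]; linarith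
      _ ≤ _ := le_add_of_nonneg_left (by positivity)
  exact abs_sub_le_of_pow_mul_eq_eval_of_lt hwN hE hN.le hP hPq hq

end IntegerNodes

section SubsetPoly

open Finset
open scoped BigOperators

variable {R R' K α : Type*} [CommSemiring R] [CommSemiring R'] [Field K] [DecidableEq α] {d e : ℕ}

variable (R α) in
/-- The functions of a finite set `S` that are polynomials of degree at most `d` in the indicator
variables of membership in `S`; the indicators being idempotent, squarefree monomials suffice. -/
def subsetPoly (d : ℕ) : Submodule R (Finset α → R) :=
  Submodule.span R {f | ∃ A : Finset α, #A ≤ d ∧ f = fun S => if A ⊆ S then 1 else 0}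

namespace subsetPoly

theorem monomial_mem {A : Finset α} (hA : #A ≤ d) :
    (fun S => if A ⊆ S then 1 else 0) ∈ subsetPoly R α d :=
  Submodule.subset_span ⟨A, hA, rfl⟩

theorem const_mem (c : R) : (fun _ => c) ∈ subsetPoly R α d := by
  simpa [Pi.smul_def] using (subsetPoly R α d).smul_mem c (monomial_mem (A := ∅) d.zero_le)

theorem mul_mem {f g : Finset α → R} (hf : f ∈ subsetPoly R α d) (hg : g ∈ subsetPoly R α e) :
    (fun S => f S * g S) ∈ subsetPoly R α (d + e) := by
  have h : subsetPoly R α d * subsetPoly R α e ≤ subsetPoly R α (d + e) := by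
    rw [subsetPoly, subsetPoly, Submodule.span_mul_span]
    refine Submodule.span_mono ?_
    rintro _ ⟨_, ⟨A, hA, rfl⟩, _, ⟨B, hB, rfl⟩, rfl⟩
    refine ⟨A ∪ B, (card_union_le A B).trans (add_le_add hA hB), funext fun S => ?_⟩
    simp only [Pi.mul_apply, union_subset_iff, ite_zero_mul_ite_zero, one_mul]
  exact h (Submodule.mul_mem_mul hf hg)

theorem const_mul_mem (c : R) {f : Finset α → R} (hf : f ∈ subsetPoly R α d) :
    (fun S => c * f S) ∈ subsetPoly R α d :=
  (subsetPoly R α d).smul_mem c hf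

protected theorem sum_mem {ι : Type*} {s : Finset ι} {f : ι → Finset α → R}
    (hf : ∀ i ∈ s, f i ∈ subsetPoly R α d) : (fun S => ∑ i ∈ s, f i S) ∈ subsetPoly R α d := by
  simpa only [Finset.sum_fn] using Submodule.sum_mem _ hf

theorem indicator_mem (i : α) : (fun S => if i ∈ S then 1 else 0) ∈ subsetPoly R α 1 := by
  simpa only [singleton_subset_iff] using monomial_mem (R := R) (card_singleton i).le

theorem prod_indicator_mem {ι : Type*} [Fintype ι] (v : ι → α) :
    (fun S => ∏ k, if v k ∈ S then 1 else 0) ∈ subsetPoly R α (Fintype.card ι) := by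
  simpa only [prod_ite_zero, prod_const_one, image_subset_iff] using
    monomial_mem (R := R) ((card_image_le (s := univ) (f := v)).trans_eq card_univ)

theorem card_mem [Finite α] : (fun S => (#S : R)) ∈ subsetPoly R α 1 := by
  have := Fintype.ofFinite α
  simpa only [sum_boole, filter_univ_mem] using
    subsetPoly.sum_mem fun i (_ : i ∈ univ) => indicator_mem (R := R) i

theorem map_mem (φ : R →+ R') {f : Finset α → R} (hf : f ∈ subsetPoly R α d) :
    (fun S => φ (f S)) ∈ subsetPoly R' α d := by
  induction hf using Submodule.span_induction generalizing φ with
  | mem f hf =>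
    obtain ⟨A, hA, rfl⟩ := hf
    simpa only [apply_ite φ, map_zero, mul_ite, mul_one, mul_zero] using
      const_mul_mem (φ 1) (monomial_mem hA)
  | zero => simpa only [Pi.zero_apply, map_zero] using const_mem 0
  | add _ _ _ _ hf hg =>
    simp only [Pi.add_apply, map_add]
    exact add_mem (hf φ) (hg φ)
  | smul c _ _ hf => exact hf (φ.comp (AddMonoidHom.mulLeft c))

theorem norm_sq_mem {f : Finset α → ℂ} (hf : f ∈ subsetPoly ℂ α d) :
    (fun S => ‖f S‖ ^ 2) ∈ subsetPoly ℝ α (d + d) := by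
  have hre := map_mem Complex.reAddGroupHom hf
  have him := map_mem Complex.imAddGroupHom hf
  simp only [Complex.sq_norm, Complex.normSq_apply]
  exact add_mem (mul_mem hre hre) (mul_mem him him)

variable [Fintype α] [CharZero K]

theorem expect_powersetCard_subset (A : Finset α) {k : ℕ} (hk : k ≤ Fintype.card α) :
    𝔼 S ∈ powersetCard k univ, (if A ⊆ S then 1 else 0 : K) =
      k.descFactorial #A / (Fintype.card α).descFactorial #A := by
  have hchoose : ((Fintype.card α).choose k : K) ≠ 0 :=
    Nat.cast_ne_zero.2 (Nat.choose_pos hk).ne'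
  have hdesc : ((Fintype.card α).descFactorial #A : K) ≠ 0 :=
    Nat.cast_ne_zero.2 (Nat.descFactorial_pos.2 (card_le_univ A)).ne'
  rw [expect_eq_sum_div_card, sum_boole, card_powersetCard, card_univ,
    div_eq_div_iff hchoose hdesc]
  norm_cast
  rcases lt_or_ge k #A with hlt | hge
  · rw [Nat.descFactorial_of_lt hlt, filter_false_of_mem, card_empty, zero_mul, zero_mul]
    intro S hS hAS
    have := card_le_card hAS
    rw [(mem_powersetCard.1 hS).2] at this
    omega
  · rw [card_filter_powersetCard_subset _ _ _ (subset_univ _) hge, card_univ,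
      Nat.descFactorial_eq_factorial_mul_choose, Nat.descFactorial_eq_factorial_mul_choose]
    linear_combination (#A).factorial * (Nat.choose_mul (n := Fintype.card α) hge).symm

open Polynomial in
theorem exists_polynomial_expect {f : Finset α → K} (hf : f ∈ subsetPoly K α d) :
    ∃ P : K[X], P.natDegree ≤ d ∧
      ∀ k ≤ Fintype.card α, 𝔼 S ∈ powersetCard k univ, f S = P.eval (k : K) := by
  induction hf using Submodule.span_induction with
  | mem f hf =>
    obtain ⟨A, hA, rfl⟩ := hf
    refine ⟨C ((Fintype.card α).descFactorial #A : K)⁻¹ * descPochhammer K #A,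
      (natDegree_C_mul_le _ _).trans (by rwa [descPochhammer_natDegree]), fun k hk => ?_⟩
    rw [expect_powersetCard_subset A hk, eval_mul, eval_C,
      descPochhammer_eval_eq_descFactorial, inv_mul_eq_div]
  | zero => exact ⟨0, by simp, by simp⟩
  | add f g _ _ hf hg =>
    obtain ⟨P, hP, hfP⟩ := hf
    obtain ⟨Q, hQ, hgQ⟩ := hg
    refine ⟨P + Q, natDegree_add_le_of_degree_le hP hQ, fun k hk => ?_⟩
    simp only [Pi.add_apply, expect_add_distrib, hfP k hk, hgQ k hk, eval_add]
  | smul c _ _ hf =>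
    obtain ⟨P, hP, hfP⟩ := hf
    refine ⟨C c * P, (natDegree_C_mul_le _ _).trans hP, fun k hk => ?_⟩
    simp only [Pi.smul_apply, smul_eq_mul, ← mul_expect, hfP k hk, eval_mul, eval_C]

end subsetPoly

end SubsetPoly

section Unitarity

open Finset Matrix

variable {N r m : ℕ}

theorem sum_norm_sq_mulVec_of_mem_unitaryGroup {n : Type*} [Fintype n] [DecidableEq n]
    {M : Matrix n n ℂ} (hM : M ∈ unitaryGroup n ℂ) (v : n → ℂ) :
    ∑ z, ‖(M *ᵥ v) z‖ ^ 2 = ∑ z, ‖v z‖ ^ 2 := by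
  have hnorm := ContinuousLinearMap.norm_map_of_mem_unitary
    (Unitary.map_mem (toEuclideanCLM (n := n) (𝕜 := ℂ)) hM) (WithLp.toLp 2 v)
  calc ∑ z, ‖(M *ᵥ v) z‖ ^ 2
      = ‖toEuclideanCLM (n := n) (𝕜 := ℂ) M (WithLp.toLp 2 v)‖ ^ 2 :=
        (EuclideanSpace.norm_sq_eq (WithLp.toLp 2 (M *ᵥ v))).symm
    _ = ‖WithLp.toLp 2 v‖ ^ 2 := by rw [hnorm]
    _ = ∑ z, ‖v z‖ ^ 2 := EuclideanSpace.norm_sq_eq (WithLp.toLp 2 v)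

theorem star_ketS (S : Finset (Fin N)) : star (ketS S) = ketS S := by
  ext i
  rw [Pi.star_apply, ketS]
  split_ifs
  · exact Complex.conj_ofReal _
  · exact star_zero _

theorem sqrt_card_mul_ketS (S : Finset (Fin N)) (i : Fin N) :
    (√(#S : ℝ) : ℂ) * ketS S i = if i ∈ S then 1 else 0 := by
  rw [ketS, mul_ite, mul_zero]
  refine ite_congr rfl (fun hi => ?_) fun _ => rfl
  have hS : √(#S : ℝ) ≠ 0 := (Real.sqrt_pos.2 (Nat.cast_pos.2 (card_pos.2 ⟨i, hi⟩))).ne'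
  rw [← Complex.ofReal_mul, mul_one_div_cancel hS, Complex.ofReal_one]

theorem sqrt_card_mul_sqrt_card (S : Finset (Fin N)) :
    (√(#S : ℝ) : ℂ) * √(#S : ℝ) = #S := by
  rw [← Complex.ofReal_mul, Real.mul_self_sqrt (Nat.cast_nonneg _), Complex.ofReal_natCast]

theorem ketS_dotProduct_ketS {S : Finset (Fin N)} (hS : S.Nonempty) : ketS S ⬝ᵥ ketS S = 1 := by
  have hS0 : (#S : ℂ) ≠ 0 := Nat.cast_ne_zero.2 hS.card_ne_zero
  refine mul_left_cancel₀ hS0 ?_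
  calc (#S : ℂ) * (ketS S ⬝ᵥ ketS S)
      = ∑ i, (√(#S : ℝ) * ketS S i) * (√(#S : ℝ) * ketS S i) := by
        rw [← sqrt_card_mul_sqrt_card, dotProduct, mul_sum]
        exact sum_congr rfl fun i _ => mul_mul_mul_comm _ _ _ _
    _ = (#S : ℂ) * 1 := by simp [sqrt_card_mul_ketS]

theorem sum_norm_sq_ketS {S : Finset (Fin N)} (hS : S.Nonempty) : ∑ i, ‖ketS S i‖ ^ 2 = 1 := by
  apply Complex.ofReal_injective
  rw [Complex.ofReal_one, ← ketS_dotProduct_ketS hS, dotProduct, Complex.ofReal_sum]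
  refine sum_congr rfl fun i _ => ?_
  rw [Complex.ofReal_pow, ← Complex.conj_mul', starRingEnd_apply, ← Pi.star_apply, star_ketS]

theorem isStarProjection_vecMulVec_ketS {S : Finset (Fin N)} (hS : S.Nonempty) :
    IsStarProjection (vecMulVec (ketS S) (ketS S)) where
  isIdempotentElem := by
    rw [IsIdempotentElem, vecMulVec_mul_vecMulVec, ketS_dotProduct_ketS hS]
    simp
  isSelfAdjoint := by
    rw [isSelfAdjoint_iff, star_eq_conjTranspose, conjTranspose_vecMulVec, star_ketS]

theorem reflectionS_mem_unitary {S : Finset (Fin N)} (hS : S.Nonempty) :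
    reflectionS S ∈ unitary (Matrix (Fin N) (Fin N) ℂ) := by
  convert (isStarProjection_vecMulVec_ketS hS).one_sub.two_mul_sub_one_mem_unitary using 1
  rw [reflectionS, star_ketS, two_mul, two_smul]
  abel

theorem membershipOracle_mem_unitary (S : Finset (Fin N)) :
    membershipOracle S ∈ unitary (Matrix (Fin N × Bool) (Fin N × Bool) ℂ) := by
  have hstar : star (membershipOracle S) = membershipOracle S := by
    rw [membershipOracle, star_eq_conjTranspose, diagonal_conjTranspose, diagonal_eq_diagonal_iff]
    intro q
    simp only [Pi.star_apply]
    split_ifs <;> simp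
  have hsq : membershipOracle S * membershipOracle S = 1 := by
    rw [membershipOracle, diagonal_mul_diagonal, ← diagonal_one, diagonal_eq_diagonal_iff]
    intro q
    split_ifs <;> norm_num
  rw [Unitary.mem_iff, hstar]
  exact ⟨hsq, hsq⟩

theorem Gate.toMatrix_mem_unitaryGroup {S : Finset (Fin N)} (hS : S.Nonempty) (g : Gate N r m) :
    g.toMatrix S ∈ unitaryGroup (BasisIdx N r m) ℂ := by
  cases g with
  | free U => exact U.2
  | query =>
    exact kronecker_mem_unitary (one_mem _)
      (kronecker_mem_unitary (membershipOracle_mem_unitary S) (one_mem _))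
  | reflect =>
    exact kronecker_mem_unitary (one_mem _) (kronecker_mem_unitary
      (kronecker_mem_unitary (reflectionS_mem_unitary hS) (one_mem _)) (one_mem _))

theorem sum_norm_sq_foldl_gates {S : Finset (Fin N)} (hS : S.Nonempty)
    (gates : List (Gate N r m)) (ψ : BasisIdx N r m → ℂ) :
    ∑ z, ‖gates.foldl (fun φ g => g.toMatrix S *ᵥ φ) ψ z‖ ^ 2 = ∑ z, ‖ψ z‖ ^ 2 := by
  induction gates generalizing ψ with
  | nil => rfl
  | cons g gates ih =>
    rw [List.foldl_cons, ih,
      sum_norm_sq_mulVec_of_mem_unitaryGroup (g.toMatrix_mem_unitaryGroup hS)]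

end Unitarity

section GateDegree

open Finset Matrix

variable {N r m : ℕ}

theorem card_mul_reflectionS_apply (S : Finset (Fin N)) (i j : Fin N) :
    (#S : ℂ) * reflectionS S i j = #S * (1 : Matrix (Fin N) (Fin N) ℂ) i j -
      2 * ((if i ∈ S then 1 else 0) * (if j ∈ S then 1 else 0)) := by
  rw [reflectionS, star_ketS, Matrix.sub_apply, Matrix.smul_apply, vecMulVec_apply, smul_eq_mul,
    ← sqrt_card_mul_ketS, ← sqrt_card_mul_ketS, ← sqrt_card_mul_sqrt_card]
  ring

theorem card_mul_reflectionS_mem_subsetPoly (i j : Fin N) :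
    (fun S => (#S : ℂ) * reflectionS S i j) ∈ subsetPoly ℂ (Fin N) 2 := by
  simp only [card_mul_reflectionS_apply]
  have hone : (fun S : Finset (Fin N) => #S * (1 : Matrix (Fin N) (Fin N) ℂ) i j) ∈
      subsetPoly ℂ (Fin N) (1 + 1) :=
    subsetPoly.mul_mem subsetPoly.card_mem (subsetPoly.const_mem _)
  have hket : (fun S : Finset (Fin N) =>
      (if i ∈ S then (1 : ℂ) else 0) * (if j ∈ S then 1 else 0)) ∈
      subsetPoly ℂ (Fin N) (1 + 1) :=
    subsetPoly.mul_mem (subsetPoly.indicator_mem i) (subsetPoly.indicator_mem j)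
  exact Submodule.sub_mem _ hone (subsetPoly.const_mul_mem 2 hket)

theorem membershipOracle_mem_subsetPoly (x y : Fin N × Bool) :
    (fun S => membershipOracle S x y) ∈ subsetPoly ℂ (Fin N) 1 := by
  simp only [membershipOracle, diagonal_apply]
  split_ifs
  · exact sub_mem (subsetPoly.const_mem 1) (subsetPoly.const_mul_mem _ (subsetPoly.indicator_mem _))
  · exact sub_mem (subsetPoly.const_mem 1) (subsetPoly.const_mul_mem _ (subsetPoly.indicator_mem _))
  · exact subsetPoly.const_mem 0

-- Each reflection needs one factor of `|S|` to clear the denominator of `|S⟩⟨S|`.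
theorem Gate.toMatrix_mem_subsetPoly (g : Gate N r m) (z y : BasisIdx N r m) :
    (fun S => (#S : ℂ) ^ g.reflectCost * g.toMatrix S z y) ∈
      subsetPoly ℂ (Fin N) (g.queryCost + 2 * g.reflectCost) := by
  cases g with
  | free U => simpa [Gate.toMatrix, Gate.reflectCost] using subsetPoly.const_mem _
  | query =>
    convert subsetPoly.const_mul_mem
      ((1 : Matrix _ _ ℂ) z.1 y.1 * (1 : Matrix _ _ ℂ) z.2.2 y.2.2)
      (membershipOracle_mem_subsetPoly z.2.1 y.2.1) using 2 with S
    · rfl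
    · simp only [Gate.toMatrix, Gate.reflectCost, kroneckerMap_apply]
      ring
  | reflect =>
    convert subsetPoly.const_mul_mem
      ((1 : Matrix _ _ ℂ) z.1 y.1 *
        ((1 : Matrix _ _ ℂ) z.2.1.2 y.2.1.2 * (1 : Matrix _ _ ℂ) z.2.2 y.2.2))
      (card_mul_reflectionS_mem_subsetPoly z.2.1.1 y.2.1.1) using 2 with S
    · rfl
    · simp only [Gate.toMatrix, Gate.reflectCost, kroneckerMap_apply]
      ring

theorem mulVec_mem_subsetPoly {n α : Type*} [Fintype n] [DecidableEq α] {d e : ℕ}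
    {M : Finset α → Matrix n n ℂ} {ψ : Finset α → n → ℂ}
    (hM : ∀ z y, (fun S => M S z y) ∈ subsetPoly ℂ α e)
    (hψ : ∀ z, (fun S => ψ S z) ∈ subsetPoly ℂ α d) (z : n) :
    (fun S => (M S *ᵥ ψ S) z) ∈ subsetPoly ℂ α (e + d) := by
  simpa only [mulVec, dotProduct] using
    subsetPoly.sum_mem fun y (_ : y ∈ univ) => subsetPoly.mul_mem (hM z y) (hψ y)

theorem foldl_gates_mem_subsetPoly (gates : List (Gate N r m)) {d : ℕ}
    {ψ : Finset (Fin N) → BasisIdx N r m → ℂ} {c : Finset (Fin N) → ℂ}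
    (hψ : ∀ z, (fun S => c S * ψ S z) ∈ subsetPoly ℂ (Fin N) d) (z : BasisIdx N r m) :
    (fun S => c S * (#S : ℂ) ^ (gates.map Gate.reflectCost).sum *
      gates.foldl (fun φ g => g.toMatrix S *ᵥ φ) (ψ S) z) ∈
      subsetPoly ℂ (Fin N)
        (d + (gates.map Gate.queryCost).sum + 2 * (gates.map Gate.reflectCost).sum) := by
  induction gates generalizing d ψ c with
  | nil => simpa using hψ z
  | cons g gates ih =>
    have hstep : ∀ z, (fun S => c S * (#S : ℂ) ^ g.reflectCost * (g.toMatrix S *ᵥ ψ S) z) ∈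
        subsetPoly ℂ (Fin N) (g.queryCost + 2 * g.reflectCost + d) := fun z => by
      convert mulVec_mem_subsetPoly (M := fun S => (#S : ℂ) ^ g.reflectCost • g.toMatrix S)
        (ψ := fun S => c S • ψ S) g.toMatrix_mem_subsetPoly hψ z using 2 with S
      rw [smul_mulVec, mulVec_smul, Pi.smul_apply, Pi.smul_apply, smul_eq_mul, smul_eq_mul]
      ring
    simp only [List.map_cons, List.sum_cons, List.foldl_cons]
    convert ih hstep using 2 with S
    · ring
    · ring

end GateDegree

namespace QAlgorithm

open Finset Matrix
open scoped BigOperators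

variable {N : ℕ} (Q : QAlgorithm N)

theorem sum_norm_sq_initialState {S : Finset (Fin N)} (hS : S.Nonempty) :
    ∑ z, ‖Q.initialState S z‖ ^ 2 = 1 := by
  have hancilla : ∀ x : Fin Q.copies → Fin N,
      ∑ y, ‖Q.initialState S (x, y)‖ ^ 2 = ∏ k, ‖ketS S (x k)‖ ^ 2 := fun x => by
    rw [sum_eq_single Q.init]
    · simp [initialState, prod_pow]
    · intro y _ hy
      simp [initialState, hy]
    · simp
  rw [Fintype.sum_prod_type, sum_congr rfl fun x _ => hancilla x,
    ← Fintype.prod_sum fun (_ : Fin Q.copies) i => ‖ketS S i‖ ^ 2]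
  simp only [sum_norm_sq_ketS hS, prod_const_one]

theorem acceptProb_nonneg (S : Finset (Fin N)) : 0 ≤ Q.acceptProb S :=
  sum_nonneg fun _ _ => sq_nonneg _

theorem acceptProb_le_one {S : Finset (Fin N)} (hS : S.Nonempty) : Q.acceptProb S ≤ 1 :=
  calc Q.acceptProb S ≤ ∑ z, ‖Q.finalState S z‖ ^ 2 :=
        sum_le_univ_sum_of_nonneg fun _ => sq_nonneg _
    _ = ∑ z, ‖Q.initialState S z‖ ^ 2 := sum_norm_sq_foldl_gates hS _ _
    _ = 1 := Q.sum_norm_sq_initialState hS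

theorem initialState_mem_subsetPoly (z : BasisIdx N Q.copies Q.workDim) :
    (fun S => (√(#S : ℝ) : ℂ) ^ Q.copies * Q.initialState S z) ∈
      subsetPoly ℂ (Fin N) Q.copies := by
  have h := subsetPoly.const_mul_mem (if z.2 = Q.init then (1 : ℂ) else 0)
    (subsetPoly.prod_indicator_mem z.1)
  rw [Fintype.card_fin] at h
  convert h using 2 with S
  simp only [initialState, ← sqrt_card_mul_ketS, prod_mul_distrib, prod_const, card_univ,
    Fintype.card_fin]
  ring

theorem finalState_mem_subsetPoly (z : BasisIdx N Q.copies Q.workDim) :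
    (fun S => (√(#S : ℝ) : ℂ) ^ Q.copies * (#S : ℂ) ^ Q.reflections * Q.finalState S z) ∈
      subsetPoly ℂ (Fin N) (Q.copies + Q.queries + 2 * Q.reflections) :=
  foldl_gates_mem_subsetPoly Q.gates Q.initialState_mem_subsetPoly z

theorem acceptProb_mem_subsetPoly :
    (fun S => (#S : ℝ) ^ (Q.copies + 2 * Q.reflections) * Q.acceptProb S) ∈
      subsetPoly ℝ (Fin N) (Q.copies + 2 * Q.reflections +
        (Q.copies + 2 * Q.reflections + 2 * Q.queries)) := by
  convert subsetPoly.sum_mem fun z (_ : z ∈ Q.accept) =>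
    subsetPoly.norm_sq_mem (Q.finalState_mem_subsetPoly z) using 2 with S
  · ring
  · rw [acceptProb, mul_sum]
    refine sum_congr rfl fun z _ => ?_
    rw [norm_mul, norm_mul, norm_pow, norm_pow, Complex.norm_real, Complex.norm_natCast,
      Real.norm_of_nonneg (Real.sqrt_nonneg _), mul_pow, mul_pow, pow_right_comm,
      Real.sq_sqrt (Nat.cast_nonneg _)]
    ring

/-- The acceptance probability when the hidden set is a uniformly random subset of size `k`. -/
noncomputable def meanAcceptProb (k : ℕ) : ℝ :=
  𝔼 S ∈ powersetCard k univ, Q.acceptProb S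

theorem le_meanAcceptProb {k : ℕ} (hk : k ≤ N) {a : ℝ}
    (h : ∀ S : Finset (Fin N), #S = k → a ≤ Q.acceptProb S) : a ≤ Q.meanAcceptProb k :=
  le_expect (powersetCard_nonempty.2 (by simpa using hk)) fun S hS => h S (mem_powersetCard.1 hS).2

theorem meanAcceptProb_le {k : ℕ} (hk : k ≤ N) {a : ℝ}
    (h : ∀ S : Finset (Fin N), #S = k → Q.acceptProb S ≤ a) : Q.meanAcceptProb k ≤ a :=
  expect_le (powersetCard_nonempty.2 (by simpa using hk)) fun S hS => h S (mem_powersetCard.1 hS).2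

theorem meanAcceptProb_mem_Icc {k : ℕ} (hk : k ∈ Icc 1 N) : Q.meanAcceptProb k ∈ Set.Icc 0 1 := by
  obtain ⟨hk1, hkN⟩ := mem_Icc.1 hk
  exact ⟨Q.le_meanAcceptProb hkN fun S _ => Q.acceptProb_nonneg S,
    Q.meanAcceptProb_le hkN fun S hS => Q.acceptProb_le_one (card_pos.1 (hS ▸ hk1))⟩

open Polynomial in
theorem exists_polynomial_meanAcceptProb :
    ∃ P : ℝ[X], P.natDegree ≤ Q.copies + 2 * Q.reflections +
        (Q.copies + 2 * Q.reflections + 2 * Q.queries) ∧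
      ∀ k ≤ N, (k : ℝ) ^ (Q.copies + 2 * Q.reflections) * Q.meanAcceptProb k =
        P.eval (k : ℝ) := by
  obtain ⟨P, hdeg, hP⟩ := subsetPoly.exists_polynomial_expect Q.acceptProb_mem_subsetPoly
  refine ⟨P, hdeg, fun k hk => ?_⟩
  rw [← hP k (by simpa using hk), meanAcceptProb, mul_expect]
  exact expect_congr rfl fun S hS => by rw [(mem_powersetCard.1 hS).2]

theorem abs_meanAcceptProb_sub_le {w : ℕ} (hw : 0 < w) (hwN : 2 * w ≤ N) :
    |Q.meanAcceptProb w - Q.meanAcceptProb (2 * w)| ≤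
      64 * (Q.copies + Q.reflections : ℝ) ^ 3 / w +
        64 * (Q.queries + (Q.copies + Q.reflections) : ℝ) ^ 2 * w / N := by
  obtain ⟨P, hdeg, hP⟩ := Q.exists_polynomial_meanAcceptProb
  have hE : (Q.copies + 2 * Q.reflections : ℝ) ≤ 2 * (Q.copies + Q.reflections) := by
    linarith [Nat.cast_nonneg (α := ℝ) Q.copies]
  have hD : (Q.copies + 2 * Q.reflections + 2 * Q.queries : ℝ) ≤
      2 * (Q.queries + (Q.copies + Q.reflections)) := by linarith
  calc |Q.meanAcceptProb w - Q.meanAcceptProb (2 * w)|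
      ≤ 8 * (Q.copies + 2 * Q.reflections : ℝ) ^ 3 / w +
          16 * (Q.copies + 2 * Q.reflections + 2 * Q.queries : ℝ) ^ 2 * w / N := by
        exact_mod_cast abs_sub_le_of_pow_mul_eq_eval hw hwN hdeg
          (fun k hk => hP k (mem_Icc.1 hk).2) fun k hk => Q.meanAcceptProb_mem_Icc hk
    _ ≤ 8 * (2 * (Q.copies + Q.reflections) : ℝ) ^ 3 / w +
          16 * (2 * (Q.queries + (Q.copies + Q.reflections)) : ℝ) ^ 2 * w / N := by gcongr
    _ = _ := by ring

end QAlgorithm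

section LowerBound

theorem pow_three_div_add_sq_mul_div_le {c n w T R : ℝ} (hc : c ≤ 1) (hn : 0 < n)
    (hw : 0 < w) (hT : 0 ≤ T) (hR : 0 ≤ R) (hTc : T < c * √(n / w))
    (hRc : R < c * min (w ^ (1 / 3 : ℝ)) √(n / w)) :
    64 * R ^ 3 / w + 64 * (T + R) ^ 2 * w / n ≤ 320 * c := by
  have hc0 : 0 < c := pos_of_mul_pos_left (hT.trans_lt hTc) (Real.sqrt_nonneg _)
  have hRw : R ≤ c * w ^ (1 / 3 : ℝ) :=
    hRc.le.trans (mul_le_mul_of_nonneg_left (min_le_left _ _) hc0.le)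
  have hRn : R ≤ c * √(n / w) :=
    hRc.le.trans (mul_le_mul_of_nonneg_left (min_le_right _ _) hc0.le)
  have hcube : R ^ 3 ≤ c ^ 3 * w := by
    calc R ^ 3 ≤ (c * w ^ (1 / 3 : ℝ)) ^ 3 := by gcongr
      _ = c ^ 3 * w := by
        rw [mul_pow, ← Real.rpow_natCast (w ^ (1 / 3 : ℝ)), ← Real.rpow_mul hw.le]
        norm_num
  have hsq : (T + R) ^ 2 ≤ 4 * c ^ 2 * (n / w) := by
    calc (T + R) ^ 2 ≤ (c * √(n / w) + c * √(n / w)) ^ 2 := by gcongr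
      _ = 4 * c ^ 2 * (n / w) := by linear_combination 4 * c ^ 2 * Real.sq_sqrt (div_pos hn hw).le
  calc 64 * R ^ 3 / w + 64 * (T + R) ^ 2 * w / n
      ≤ 64 * (c ^ 3 * w) / w + 64 * (4 * c ^ 2 * (n / w)) * w / n := by gcongr
    _ = 64 * c ^ 3 + 256 * c ^ 2 := by field_simp; ring
    _ ≤ 64 * c + 256 * c := by
      gcongr
      · exact pow_le_of_le_one hc0.le hc three_ne_zero
      · exact pow_le_of_le_one hc0.le hc two_ne_zero
    _ = 320 * c := by ring

theorem theorem1p3_general (ε : ℝ) (hε : 0 < ε) :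
    ∃ c : ℝ, 0 < c ∧ ∀ N w : ℕ, 1 ≤ w → 2 * w ≤ N → ∀ Q : QAlgorithm N,
      ε ≤ |Q.meanAcceptProb w - Q.meanAcceptProb (2 * w)| →
        c * √((N : ℝ) / (w : ℝ)) ≤ (Q.queries : ℝ) ∨
        c * min ((w : ℝ) ^ ((1 : ℝ) / 3)) (√((N : ℝ) / (w : ℝ))) ≤
          ((Q.copies + Q.reflections : ℕ) : ℝ) := by
  refine ⟨min 1 (ε / 400), by positivity, fun N w hw hwN Q hgap => ?_⟩
  by_contra! ⟨hT, hR⟩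
  rw [Nat.cast_add] at hR
  have hsmall := pow_three_div_add_sq_mul_div_le (min_le_left _ _)
    (Nat.cast_pos.2 (by omega)) (Nat.cast_pos.2 hw) (Nat.cast_nonneg _) (by positivity) hT hR
  have hlarge := hgap.trans (Q.abs_meanAcceptProb_sub_le hw hwN)
  linarith [min_le_right 1 (ε / 400)]

theorem QAlgorithm.Decides.le_abs_meanAcceptProb_sub {N w : ℕ} {p : ℝ} {Q : QAlgorithm N}
    (hQ : Q.Decides w p) (hwN : 2 * w ≤ N) :
    2 * p - 1 ≤ |Q.meanAcceptProb w - Q.meanAcceptProb (2 * w)| := by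
  have hreject := Q.meanAcceptProb_le (by omega) fun S hS => le_sub_comm.1 (hQ.1 S hS)
  have haccept := Q.le_meanAcceptProb hwN hQ.2
  rw [abs_sub_comm]
  exact le_trans (by linarith) (le_abs_self _)

end LowerBound

theorem theorem1p3 (p : ℝ) (hp : 1 / 2 < p) :
    ∃ c : ℝ, 0 < c ∧ ∀ N w : ℕ, 1 ≤ w → 2 * w ≤ N →
      ∀ (Q : QAlgorithm N) (T R : ℕ), Q.queries = T → Q.copies + Q.reflections = R →
        Q.Decides w p →
          c * √((N : ℝ) / (w : ℝ)) ≤ (T : ℝ) ∨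
          c * min ((w : ℝ) ^ ((1 : ℝ) / 3)) (√((N : ℝ) / (w : ℝ))) ≤ (R : ℝ) := by
  obtain ⟨c, hc, h⟩ := theorem1p3_general (2 * p - 1) (by linarith)
  exact ⟨c, hc, fun N w hw hwN Q _ _ hT hR hQ =>
    hT ▸ hR ▸ h N w hw hwN Q (hQ.le_abs_meanAcceptProb_sub hwN)⟩
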